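/- Let $X$ be a real Hilbert space and $f:X\to\mathbb R$ lower semicontinuous; write $\mathrm{lev}_{\le c}f=\{x: f(x)\le c\}$, and identify $X^*$ with $X$. **Level set algorithm.** Let $U\subset X$ be open and path connected and $x_0,y_0\in U$. Start with $i=0$, a lower bound $l$ and an upper bound $u$ of $\inf_p\sup_t f(p(t))$, the infimum over continuous paths $p:[0,1]\to U$ from $x_0$ to $y_0$. At each step put $m=\frac12(l+u)$ and let $S_1,S_2$ be the path components of $(\mathrm{lev}_{\le m}f)\cap U$ containing $x_i$ and $y_i$ respectively. If $S_1=S_2$, replace $u$ by $m$. Otherwise replace $l$ by $m$, let $(x_{i+1},y_{i+1})\in S_1\times S_2$ be a minimizer of $|x-y|$ over $x\in S_1,\ y\in S_2$, put $l_{i+1}=m$, and increase $i$ by $1$. Suppose the algorithm produces infinite sequences $(x_i),(y_i)$ (in particular, the minimizers exist). If $X$ is infinite-dimensional, assume moreover that for every $i\ge1$ the point $x_i$ is not in the closure of the union of the path components of $(\mathrm{lev}_{\le l_i}f)\cap U$ other than its own, and likewise for $y_i$ (this is automatic if the path components are relatively open in $(\mathrm{lev}_{\le l_i}f)\cap U$).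 **Subdifferentials.** $\partial_Ff(x)$ is the set of $x^*$ with $\liminf_{|h|\to0}\frac{f(x+h)-f(x)-\langle x^*,h\rangle}{|h|}\ge0$, $$\partial_C^\infty f(\bar x)=\mathrm{cl\,conv}\{\text{w-}\lim_k \lambda_kx_k^*: x_k^*\in\partial_Ff(x_k),\ (x_k,f(x_k))\to(\bar x,f(\bar x)),\ \lambda_k\to0_+\},$$ $$\partial_C f(\bar x)=\mathrm{cl\,conv}\{\text{w-}\lim_k x_k^*: x_k^*\in\partial_Ff(x_k),\ (x_k,f(x_k))\to(\bar x,f(\bar x))\}+\partial_C^\infty f(\bar x),$$ and $\bar x$ is Clarke critical if $0\in\partial_Cf(\bar x)$. **Theorem.** Let $\bar z\in X$ be such that $(\bar z,\bar z)$ is a limit point of $\{(x_i,y_i)\}_{i\ge1}$ and $f$ is continuous at $\bar z$. Then one of the following holds: (a) $\bar z$ is a Clarke critical point; (b) $\partial_C^\infty f(\bar z)$ contains a line through the origin; (c) $\frac{y_i-x_i}{|y_i-x_i|}$ converges weakly to zero along every subsequence of indices along which $(x_i,y_i)\to(\bar z,\bar z)$. -/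

import Mathlib

open Filter Topology Set
open scoped Pointwise

/-- The lower level set `{x | f x ≤ c}`. -/
def lowerLevel {X : Type*} (f : X → ℝ) (c : ℝ) : Set X := {x | f x ≤ c}

/-- The objective of the mountain pass problem for `f` restricted to `U` between `a` and `b`:
the infimum, over continuous paths in `U` from `a` to `b`, of the supremum of `f` on the path. -/
noncomputable def mountainPassValue {X : Type*} [TopologicalSpace X]
    (f : X → ℝ) (U : Set X) (a b : X) : EReal :=
  ⨅ p : {p : Path a b // ∀ t, p t ∈ U}, ⨆ t : unitInterval, ((f (p.1 t) : ℝ) : EReal)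

/-- `(p, q)` minimizes the distance over `S × T`. -/
def IsClosestPair {X : Type*} [PseudoMetricSpace X] (S T : Set X) (p q : X) : Prop :=
  p ∈ S ∧ q ∈ T ∧ ∀ s ∈ S, ∀ t ∈ T, dist p q ≤ dist s t

/-- An infinite run of the level set (bisection) algorithm for `f` restricted to `U`.
The index `k` counts bisection steps: before step `k` the bounds are `l k`, `u k`, and the current
iterates are `x (i k)`, `y (i k)`.  The level of the step is the midpoint of the bounds, and
components are path components of the lower level set intersected with `U`. -/
structure IsLevelSetRun {X : Type*} [PseudoMetricSpace X] (f : X → ℝ) (U : Set X)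
    (x y : ℕ → X) (l u : ℕ → ℝ) (i : ℕ → ℕ) : Prop where
  isOpen : IsOpen U
  isPathConnected : IsPathConnected U
  x_zero_mem : x 0 ∈ U
  y_zero_mem : y 0 ∈ U
  lower_bound : (l 0 : EReal) ≤ mountainPassValue f U (x 0) (y 0)
  upper_bound : mountainPassValue f U (x 0) (y 0) ≤ (u 0 : EReal)
  index_zero : i 0 = 0
  step : ∀ k,
    -- same component: the midpoint becomes the upper bound
    (JoinedIn (lowerLevel f ((l k + u k) / 2) ∩ U) (x (i k)) (y (i k)) ∧
      l (k + 1) = l k ∧ u (k + 1) = (l k + u k) / 2 ∧ i (k + 1) = i k) ∨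
    -- different components: the midpoint becomes the lower bound, and new iterates are found
    (¬ JoinedIn (lowerLevel f ((l k + u k) / 2) ∩ U) (x (i k)) (y (i k)) ∧
      l (k + 1) = (l k + u k) / 2 ∧ u (k + 1) = u k ∧ i (k + 1) = i k + 1 ∧
      IsClosestPair
        (pathComponentIn (lowerLevel f ((l k + u k) / 2) ∩ U) (x (i k)))
        (pathComponentIn (lowerLevel f ((l k + u k) / 2) ∩ U) (y (i k)))
        (x (i k + 1)) (y (i k + 1)))
  -- infinitely many iterates are produced
  infinite : Tendsto i atTop atTop

/-- Points of `A` outside the path component of `p` in `A` do not accumulate at `p`. -/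
def OtherComponentsAvoid {X : Type*} [TopologicalSpace X] (A : Set X) (p : X) : Prop :=
  p ∉ closure (A \ pathComponentIn A p)

section Subdifferentials

variable {X : Type*} [NormedAddCommGroup X] [InnerProductSpace ℝ X]

/-- Weak convergence of a sequence in a real Hilbert space (the dual is identified with the space
through the inner product). -/
def WeaklyTendsTo (v : ℕ → X) (w : X) : Prop :=
  ∀ z : X, Tendsto (fun k => inner ℝ (v k) z) atTop (𝓝 (inner ℝ w z))

/-- The Fréchet subdifferential: `liminf_{h → 0} (f (x + h) - f x - ⟪ξ, h⟫) / ‖h‖ ≥ 0`,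
written with the denominator cleared. -/
def frechetSubdiff (f : X → ℝ) (x : X) : Set X :=
  {ξ | ∀ ε : ℝ, 0 < ε → ∀ᶠ h in 𝓝 (0 : X), -(ε * ‖h‖) ≤ f (x + h) - f x - inner ℝ ξ h}

/-- Weak limits of Fréchet subgradients of `f` at points `xₖ` with
`(xₖ, f xₖ) → (x, f x)`. -/
def limitingSubgradients (f : X → ℝ) (x : X) : Set X :=
  {ξ | ∃ (p : ℕ → X) (g : ℕ → X), (∀ k, g k ∈ frechetSubdiff f (p k)) ∧
    Tendsto p atTop (𝓝 x) ∧ Tendsto (fun k => f (p k)) atTop (𝓝 (f x)) ∧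
    WeaklyTendsTo g ξ}

/-- Weak limits of `λₖ • gₖ` with `λₖ → 0₊` and `gₖ` Fréchet subgradients of `f` at points `xₖ`
with `(xₖ, f xₖ) → (x, f x)`. -/
def singularSubgradients (f : X → ℝ) (x : X) : Set X :=
  {ξ | ∃ (p : ℕ → X) (g : ℕ → X) (r : ℕ → ℝ), (∀ k, g k ∈ frechetSubdiff f (p k)) ∧
    Tendsto p atTop (𝓝 x) ∧ Tendsto (fun k => f (p k)) atTop (𝓝 (f x)) ∧
    Tendsto r atTop (𝓝[>] 0) ∧ WeaklyTendsTo (fun k => r k • g k) ξ}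

/-- The singular Clarke subdifferential. -/
def clarkeSingularSubdiff (f : X → ℝ) (x : X) : Set X :=
  closure (convexHull ℝ (singularSubgradients f x))

/-- The Clarke subdifferential of a lower semicontinuous function. -/
def clarkeSubdiff (f : X → ℝ) (x : X) : Set X :=
  closure (convexHull ℝ (limitingSubgradients f x)) + clarkeSingularSubdiff f x

/-- Clarke critical points. -/
def IsClarkeCritical (f : X → ℝ) (x : X) : Prop := (0 : X) ∈ clarkeSubdiff f x

/-- `S` contains a line through the origin. -/
def ContainsLineThroughZero (S : Set X) : Prop := ∃ v : X, v ≠ 0 ∧ ∀ t : ℝ, t • v ∈ S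

end Subdifferentials

/-! If Fréchet subgradients of arbitrarily small norm occur arbitrarily near the limit point, it is
Clarke critical. Otherwise their norms are at least some ε > 0 near it. This gives an error bound: a
point where f slightly exceeds m has points of {f ≤ m} at a distance controlled by the excess
(`exists_le_of_frechetSubdiff_norm_ge`). The constraint f ≤ m can then be penalized, and since x_i
is a closest point to y_i in its component, a fuzzy multiplier rule follows: the unit vector d_i
from x_i to y_i is, to any precision, t • ξ with t > 0 and ξ a Fréchet subgradient near x_i. By
symmetry -d_i is so approximated near y_i (`IsLevelSetRun.exists_multipliers`).

If d_i does not tend weakly to 0, a subsequence tends weakly to some v ≠ 0. The multipliers are at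
most 2/ε, so v is a singular subgradient (t → 0) or a positive multiple of a limiting one, and the
same holds for -v. Two singular subgradients span a line; every other combination cancels to 0 in
the Clarke subdifferential.

In finite dimension other components may accumulate at x_i, which then need not be a local minimizer
over the level set. `exists_small_slope_of_min_on_pathComponentIn` supplies a nearby point where the
distance to y_i has small slope: otherwise descending chains would converge to a path, inside the
component, to a point closer to y_i. -/

section
-- Variational principle and error bound
variable {X : Type*} [NormedAddCommGroup X] [InnerProductSpace ℝ X]

/-- **Borwein–Preiss variational principle** in a Hilbert space: near an approximate minimizer of a
lower semicontinuous function there is a point with a small proximal subgradient. -/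
theorem exists_proximal_subgradient_of_approx_min [CompleteSpace X] {C : Set X} (hC : IsClosed C)
    {F : X → ℝ} (hF : LowerSemicontinuous F) {p : X} (hp : p ∈ C) {e r : ℝ} (he : 0 < e)
    (hr : 0 < r) (hmin : ∀ x ∈ C, F p ≤ F x + e) :
    ∃ w ∈ C, ∃ ζ : X, ‖w - p‖ ≤ r ∧ ‖ζ‖ ≤ 4 * e / r ∧
      ∀ x ∈ C, F w + inner ℝ ζ (x - w) - 2 * e / r ^ 2 * ‖x - w‖ ^ 2 ≤ F x := by
  -- The ratio η k / μ k = r² 2⁻ᵏ bounds the squared distance moved from stage k on, while ∑ μ k =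
  -- 2e/r² is the final quadratic coefficient.
  set μ : ℕ → ℝ := fun k => e / r ^ 2 * (1 / 2) ^ k with hμ
  set η : ℕ → ℝ := fun k => e * (1 / 4) ^ k with hη
  have hμ0 : ∀ k, 0 < μ k := fun k => by positivity
  have hη0 : ∀ k, 0 < η k := fun k => by positivity
  -- A state is a finite-stage perturbed function together with an approximate minimizer of it.
  let Good : ℕ → (X → ℝ) × X → Prop := fun k s =>
    s.2 ∈ C ∧ LowerSemicontinuous s.1 ∧ ∀ x ∈ C, s.1 s.2 ≤ s.1 x + η k
  have hstep : ∀ k (s : (X → ℝ) × X), Good k s → ∃ x' : X,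
      Good (k + 1) (fun x => s.1 x + μ k * ‖x - s.2‖ ^ 2, x') ∧
        s.1 x' + μ k * ‖x' - s.2‖ ^ 2 ≤ s.1 s.2 := by
    rintro k ⟨J, v⟩ ⟨hv, hJ, hm⟩
    simp only at hv hJ hm
    set J' : X → ℝ := fun x => J x + μ k * ‖x - v‖ ^ 2 with hJ'
    have hlsc : LowerSemicontinuous J' := by
      apply hJ.add
      exact Continuous.lowerSemicontinuous (by fun_prop)
    have hbdd : BddBelow (J' '' C) := by
      refine ⟨J v - η k, ?_⟩
      rintro _ ⟨x, hx, rfl⟩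
      have h1 := hm x hx
      have h2 : 0 ≤ μ k * ‖x - v‖ ^ 2 := mul_nonneg (hμ0 k).le (by positivity)
      simp only [hJ']; linarith
    have hne : (J' '' C).Nonempty := ⟨_, v, hv, rfl⟩
    have hJv : J' v = J v := by simp [hJ']
    -- Keeping v whenever it is already good enough ensures that the value at the current point
    -- never increases.
    by_cases hcase : J' v ≤ sInf (J' '' C) + η (k + 1)
    · refine ⟨v, ⟨hv, hlsc, fun x hx => ?_⟩, by simp⟩
      have := csInf_le hbdd ⟨x, hx, rfl⟩
      simp only at *; linarith
    · obtain ⟨_, ⟨x', hx', rfl⟩, hlt⟩ :=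
        exists_lt_of_csInf_lt hne (lt_add_of_pos_right (sInf (J' '' C)) (hη0 (k + 1)))
      refine ⟨x', ⟨hx', hlsc, fun x hx => ?_⟩, ?_⟩
      · have := csInf_le hbdd ⟨x, hx, rfl⟩
        simp only at *; linarith
      · push Not at hcase
        change J' x' ≤ J v
        linarith
  choose! nxt hnxt1 hnxt2 using hstep
  let st : ℕ → (X → ℝ) × X := fun k => Nat.rec (F, p)
    (fun k s => (fun x => s.1 x + μ k * ‖x - s.2‖ ^ 2, nxt k s)) k
  have hst : ∀ k, Good k (st k) := by
    intro k
    induction k with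
    | zero => exact ⟨hp, hF, fun x hx => by simpa [hη, st] using hmin x hx⟩
    | succ k ih => exact hnxt1 k _ ih
  set J : ℕ → X → ℝ := fun k => (st k).1 with hJdef
  set v : ℕ → X := fun k => (st k).2 with hvdef
  have hJs : ∀ k x, J (k + 1) x = J k x + μ k * ‖x - v k‖ ^ 2 := fun k x => rfl
  have hdec : ∀ k, J (k + 1) (v (k + 1)) ≤ J k (v k) := fun k => hnxt2 k _ (hst k)
  have hJmono : ∀ x, Monotone fun k => J k x := fun x => monotone_nat_of_le_succ fun k => by
    simp only [hJs]
    nlinarith [mul_nonneg (hμ0 k).le (sq_nonneg ‖x - v k‖)]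
  have hvdec : Antitone fun k => J k (v k) := antitone_nat_of_succ_le hdec
  have hclose : ∀ k, ∀ x ∈ C, J (k + 1) x ≤ J k (v k) → ‖x - v k‖ ^ 2 ≤ r ^ 2 * (1 / 2) ^ k := by
    intro k x hx h
    have h1 := (hst k).2.2 x hx
    change J k (v k) ≤ J k x + η k at h1
    rw [hJs] at h
    have h2 : μ k * ‖x - v k‖ ^ 2 ≤ η k := by linarith
    have h3 : η k = μ k * (r ^ 2 * (1 / 2) ^ k) := by
      simp only [hη, hμ]
      have : (1 / 4 : ℝ) ^ k = (1 / 2) ^ k * (1 / 2) ^ k := by rw [← mul_pow]; norm_num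
      rw [this]; field_simp
    rw [h3] at h2
    exact le_of_mul_le_mul_left h2 (hμ0 k)
  have hdist : ∀ k j, k ≤ j → ‖v j - v k‖ ^ 2 ≤ r ^ 2 * (1 / 2) ^ k := by
    intro k j hkj
    rcases hkj.eq_or_lt with rfl | hlt
    · simp; positivity
    · exact hclose k _ (hst j).1 ((hJmono _ hlt).trans (hvdec hkj))
  have hcauchy : CauchySeq v := by
    refine cauchySeq_of_le_tendsto_0' (fun k => Real.sqrt (r ^ 2 * (1 / 2) ^ k)) ?_ ?_
    · intro n m h
      rw [dist_comm, dist_eq_norm]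
      exact Real.le_sqrt_of_sq_le (hdist n m h)
    · have : Tendsto (fun k : ℕ => r ^ 2 * (1 / 2 : ℝ) ^ k) atTop (𝓝 0) := by
        simpa using (tendsto_pow_atTop_nhds_zero_of_lt_one (r := (1 / 2 : ℝ)) (by norm_num)
          (by norm_num)).const_mul (r ^ 2)
      have h2 := (Real.continuous_sqrt.tendsto 0).comp this
      rw [Real.sqrt_zero] at h2
      exact h2
  obtain ⟨w, hw⟩ := cauchySeq_tendsto_of_complete hcauchy
  have hwC : w ∈ C := hC.mem_of_tendsto hw (Eventually.of_forall fun k => (hst k).1)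
  have hJw : ∀ k, J (k + 1) w ≤ J k (v k) := by
    intro k
    have hcl : IsClosed {x | J (k + 1) x ≤ J k (v k)} := (hst (k + 1)).2.1.isClosed_preimage _
    exact hcl.mem_of_tendsto hw ((eventually_ge_atTop (k + 1)).mono fun j hj =>
      (hJmono _ hj).trans (hvdec (by omega)))
  have hwv : ∀ k, ‖w - v k‖ ^ 2 ≤ r ^ 2 * (1 / 2) ^ k := fun k => hclose k w hwC (hJw k)
  have hwv' : ∀ k, ‖w - v k‖ ≤ r := fun k => by
    have h1 : (1 / 2 : ℝ) ^ k ≤ 1 := pow_le_one₀ (by norm_num) (by norm_num)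
    have h2 := hwv k
    nlinarith [norm_nonneg (w - v k), sq_nonneg r]
  have hbd : ∀ k, ‖μ k • (w - v k)‖ ≤ e / r * (1 / 2) ^ k := fun k => by
    rw [norm_smul, Real.norm_of_nonneg (hμ0 k).le]
    calc μ k * ‖w - v k‖ ≤ μ k * r := mul_le_mul_of_nonneg_left (hwv' k) (hμ0 k).le
      _ = e / r * (1 / 2) ^ k := by simp only [hμ]; field_simp
  have hgeo : HasSum (fun k : ℕ => e / r * (1 / 2 : ℝ) ^ k) (e / r * 2) :=
    hasSum_geometric_two.mul_left _
  have hsum : Summable fun k => μ k • (w - v k) := Summable.of_norm_bounded hgeo.summable hbd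
  -- Recentred at w, the accumulated penalties are one linear and one quadratic term, so only their
  -- coefficients need to pass to the limit.
  have hJform : ∀ k x, J k x = J k w + (F x - F w) +
      2 * inner ℝ (∑ j ∈ Finset.range k, μ j • (w - v j)) (x - w) +
      (∑ j ∈ Finset.range k, μ j) * ‖x - w‖ ^ 2 := by
    intro k x
    induction k with
    | zero => simp [hJdef, st]
    | succ k ih =>
      rw [hJs, hJs, Finset.sum_range_succ, Finset.sum_range_succ, inner_add_left, ih]
      have : ‖x - v k‖ ^ 2 = ‖w - v k‖ ^ 2 + 2 * inner ℝ (w - v k) (x - w) + ‖x - w‖ ^ 2 := by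
        rw [← norm_add_sq_real]; congr 2; abel
      rw [this, real_inner_smul_left]; ring
  have hμsum : ∀ k, ∑ j ∈ Finset.range k, μ j ≤ 2 * e / r ^ 2 := by
    intro k
    have h1 : HasSum μ (e / r ^ 2 * 2) := hasSum_geometric_two.mul_left _
    have := h1.summable.sum_le_tsum (Finset.range k) (fun j _ => (hμ0 j).le)
    rw [h1.tsum_eq] at this
    linarith [show e / r ^ 2 * 2 = 2 * e / r ^ 2 by ring]
  refine ⟨w, hwC, (-2 : ℝ) • ∑' k, μ k • (w - v k), ?_, ?_, ?_⟩
  · exact hwv' 0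
  · have := tsum_of_norm_bounded hgeo hbd
    rw [norm_smul]
    calc ‖(-2 : ℝ)‖ * ‖∑' k, μ k • (w - v k)‖ ≤ 2 * (e / r * 2) := by
          norm_num; linarith
      _ = 4 * e / r := by ring
  · intro x hx
    have hlim : Tendsto (fun k => F w - 2 * inner ℝ (∑ j ∈ Finset.range (k + 1), μ j • (w - v j))
        (x - w) - 2 * e / r ^ 2 * ‖x - w‖ ^ 2 - η k) atTop
        (𝓝 (F w - 2 * inner ℝ (∑' k, μ k • (w - v k)) (x - w)
          - 2 * e / r ^ 2 * ‖x - w‖ ^ 2 - 0)) := by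
      have h1 : Tendsto (fun k => ∑ j ∈ Finset.range (k + 1), μ j • (w - v j)) atTop
          (𝓝 (∑' k, μ k • (w - v k))) := hsum.hasSum.tendsto_sum_nat.comp (tendsto_add_atTop_nat 1)
      have h2 : Tendsto η atTop (𝓝 0) := by
        have := (tendsto_pow_atTop_nhds_zero_of_lt_one (r := (1 / 4 : ℝ)) (by norm_num)
          (by norm_num)).const_mul e
        rwa [mul_zero] at this
      have h3 := h1.inner (𝕜 := ℝ) (tendsto_const_nhds (x := x - w))
      exact (((h3.const_mul 2).const_sub _).sub_const _).sub h2
    have hle := le_of_tendsto' hlim (b := F x) fun k => by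
      have h1 := (hst k).2.2 x hx
      change J k (v k) ≤ J k x + η k at h1
      have h2 := hJw k
      have h3 := hJmono x (Nat.le_succ k)
      have h4 := hJform (k + 1) x
      have h5 := mul_le_mul_of_nonneg_right (hμsum (k + 1)) (sq_nonneg ‖x - w‖)
      simp only at h3
      linarith
    rw [real_inner_smul_left]
    linarith

/-- A local proximal inequality yields a Fréchet subgradient. -/
theorem mem_frechetSubdiff_of_quadratic_bound {f : X → ℝ} {w ζ : X} {M : ℝ}
    (h : ∀ᶠ x in 𝓝 w, f w + inner ℝ ζ (x - w) - M * ‖x - w‖ ^ 2 ≤ f x) :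
    ζ ∈ frechetSubdiff f w := by
  intro ε hε
  have h1 : Tendsto (fun h : X => w + h) (𝓝 0) (𝓝 w) := by
    simpa using (tendsto_id (x := 𝓝 (0 : X))).const_add w
  have h2 : Tendsto (fun h : X => M * ‖h‖) (𝓝 0) (𝓝 0) := by
    simpa using (tendsto_norm_zero (E := X)).const_mul M
  filter_upwards [h1.eventually h, h2.eventually_lt_const hε] with v hv hv2
  simp only [add_sub_cancel_left] at hv
  nlinarith [norm_nonneg v]

/-- If Fréchet subgradients of `f` are bounded away from zero on a ball, then points with `f` only
slightly above `m` have points of `{f ≤ m}` nearby. -/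
theorem exists_le_of_frechetSubdiff_norm_ge [CompleteSpace X] {f : X → ℝ}
    (hf : LowerSemicontinuous f) {z : X} {ρ ε : ℝ} (hε : 0 < ε)
    (hbig : ∀ x ∈ Metric.ball z ρ, ∀ ξ ∈ frechetSubdiff f x, ε ≤ ‖ξ‖)
    {x : X} {m r : ℝ} (hr : 0 < r) (hx : Metric.closedBall x r ⊆ Metric.ball z ρ)
    (hfx : f x ≤ m + ε / 16 * r) : ∃ x' ∈ Metric.closedBall x r, f x' ≤ m := by
  -- Otherwise x is an (ε/16)r-minimizer on the ball. Radius r/2 keeps the new point interior and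
  -- yields a subgradient of norm at most ε/2 < ε.
  by_contra! hcon
  obtain ⟨w, hw, ζ, hwx, hζ, hq⟩ := exists_proximal_subgradient_of_approx_min
    (C := Metric.closedBall x r) Metric.isClosed_closedBall hf (p := x)
    (Metric.mem_closedBall_self hr.le) (e := ε / 16 * r) (r := r / 2) (by positivity)
    (by positivity) (fun y hy => by linarith [hcon y hy])
  have hmem : ζ ∈ frechetSubdiff f w := by
    refine mem_frechetSubdiff_of_quadratic_bound
      (eventually_of_mem (Metric.closedBall_mem_nhds_of_mem ?_) hq)
    rw [Metric.mem_ball, dist_eq_norm]; linarith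
  have h1 := hbig w (hx hw) ζ hmem
  have h2 : 4 * (ε / 16 * r) / (r / 2) = ε / 2 := by field_simp; norm_num
  linarith

/-! ### Weak compactness -/

/-- Weak sequential compactness of bounded sets in a Hilbert space. -/
theorem exists_subseq_weaklyTendsTo [CompleteSpace X] (d : ℕ → X) {R : ℝ}
    (hd : ∀ n, ‖d n‖ ≤ R) : ∃ v : X, ∃ φ : ℕ → ℕ, StrictMono φ ∧ WeaklyTendsTo (d ∘ φ) v := by
  -- Sequential compactness of dual balls needs separability, so one works in the closed span of the
  -- sequence and tests against projections.
  set V : Submodule ℝ X := (Submodule.span ℝ (range d)).topologicalClosure with hV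
  have hdV : ∀ n, d n ∈ V := fun n =>
    Submodule.le_topologicalClosure _ (Submodule.subset_span ⟨n, rfl⟩)
  have : CompleteSpace V :=
    (Submodule.isClosed_topologicalClosure _).completeSpace_coe
  have : TopologicalSpace.SeparableSpace V := by
    have h : TopologicalSpace.IsSeparable (V : Set X) := by
      rw [hV, Submodule.topologicalClosure_coe]
      exact ((countable_range d).isSeparable.span (R := ℝ)).closure
    exact h.separableSpace
  let D : ℕ → WeakDual ℝ V := fun n =>
    StrongDual.toWeakDual (InnerProductSpace.toDual ℝ V ⟨d n, hdV n⟩)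
  have hD : ∀ n, D n ∈ WeakDual.toStrongDual ⁻¹' Metric.closedBall (0 : StrongDual ℝ V) R := by
    intro n
    change InnerProductSpace.toDual ℝ V ⟨d n, hdV n⟩ ∈ Metric.closedBall (0 : StrongDual ℝ V) R
    rw [mem_closedBall_zero_iff, LinearIsometryEquiv.norm_map]
    exact hd n
  obtain ⟨L, -, φ, hφ, hL⟩ := WeakDual.isSeqCompact_closedBall ℝ V (0 : StrongDual ℝ V) R hD
  refine ⟨((InnerProductSpace.toDual ℝ V).symm (WeakDual.toStrongDual L) : V), φ, hφ, fun x => ?_⟩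
  have h1 : Tendsto (fun n => D (φ n) (V.orthogonalProjectionOnto x)) atTop
      (𝓝 (L (V.orthogonalProjectionOnto x))) :=
    ((WeakDual.eval_continuous (V.orthogonalProjectionOnto x)).tendsto L).comp hL
  have h2 : ∀ v : V, inner ℝ (v : X) x = inner ℝ v (V.orthogonalProjectionOnto x) := fun v => by
    rw [Submodule.inner_orthogonalProjectionOnto_eq_of_mem_left]
  have h3 : inner ℝ (((InnerProductSpace.toDual ℝ V).symm (WeakDual.toStrongDual L) : V) : X) x =
      L (V.orthogonalProjectionOnto x) := by
    rw [h2, InnerProductSpace.toDual_symm_apply]; rfl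
  rw [h3]
  refine h1.congr fun n => ?_
  exact (h2 ⟨d (φ n), hdV _⟩).symm

end

/-! ### Multiplier rule by exponential penalization -/

section
variable {X : Type*} [NormedAddCommGroup X] [InnerProductSpace ℝ X]

/-- A proximal subgradient of `exp ∘ f` (up to affine changes) yields a Fréchet subgradient
of `f` by the chain rule. -/
theorem mem_frechetSubdiff_of_exp_quadratic_bound {f : X → ℝ} {w η : X} {M N m σ : ℝ}
    (hN : 0 < N) (hσ : 0 < σ)
    (h : ∀ᶠ x in 𝓝 w, σ * Real.exp (N * (f w - m)) + inner ℝ η (x - w) - M * ‖x - w‖ ^ 2 ≤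
      σ * Real.exp (N * (f x - m))) :
    (N * (σ * Real.exp (N * (f w - m))))⁻¹ • η ∈ frechetSubdiff f w := by
  set E : ℝ := σ * Real.exp (N * (f w - m)) with hE
  have hE0 : 0 < E := by positivity
  set B : ℝ := E⁻¹ * (‖η‖ + |M|) with hB
  have hB0 : 0 ≤ B := by positivity
  refine mem_frechetSubdiff_of_quadratic_bound (M := N⁻¹ * (E⁻¹ * M + 2 * B ^ 2)) ?_
  have hnorm : Tendsto (fun x => ‖x - w‖) (𝓝 w) (𝓝 0) := tendsto_norm_sub_self w
  have hBn : Tendsto (fun x => B * ‖x - w‖) (𝓝 w) (𝓝 0) := by simpa using hnorm.const_mul B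
  filter_upwards [h, hnorm.eventually_lt_const one_pos,
    hBn.eventually_lt_const (show (0 : ℝ) < 1 / 2 by norm_num)] with x hx hx1 hx2
  set n := ‖x - w‖ with hn
  have hn0 : 0 ≤ n := norm_nonneg _
  set u : ℝ := E⁻¹ * (inner ℝ η (x - w) - M * n ^ 2) with hu
  have habs : |u| ≤ B * n := by
    rw [hu, abs_mul, abs_of_pos (inv_pos.2 hE0), hB, mul_assoc]
    refine mul_le_mul_of_nonneg_left ?_ (inv_pos.2 hE0).le
    calc |inner ℝ η (x - w) - M * n ^ 2| ≤ |inner ℝ η (x - w)| + |M * n ^ 2| := abs_sub _ _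
      _ ≤ ‖η‖ * n + |M| * n := by
        refine add_le_add (abs_real_inner_le_norm _ _) ?_
        rw [abs_mul, abs_of_nonneg (sq_nonneg n)]
        exact mul_le_mul_of_nonneg_left (by nlinarith) (abs_nonneg M)
      _ = (‖η‖ + |M|) * n := by ring
  have hu1 : -(1 / 2) < u := by linarith [neg_abs_le u]
  have hu2 : u ^ 2 ≤ (B * n) ^ 2 :=
    sq_le_sq' (by linarith [neg_abs_le u]) (by linarith [le_abs_self u])
  have hexp : 1 + u ≤ Real.exp (N * (f x - f w)) := by
    have h1 : σ * Real.exp (N * (f x - m)) = E * Real.exp (N * (f x - f w)) := by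
      rw [hE, mul_assoc, ← Real.exp_add]; congr 2; ring
    have h2 : E * (1 + u) = E + inner ℝ η (x - w) - M * n ^ 2 := by
      rw [hu]; field_simp; ring
    rw [h1] at hx
    exact le_of_mul_le_mul_left (by linarith) hE0
  -- For u > -1/2, log (1 + u) ≥ u - 2u²; as |u| ≤ B‖x - w‖, the loss is absorbed by the quadratic
  -- term.
  have hlog : u - 2 * u ^ 2 ≤ N * (f x - f w) := by
    have h0 : 0 < 1 + u := by linarith
    have h1 := Real.one_sub_inv_le_log_of_pos h0
    have h2 : Real.log (1 + u) ≤ N * (f x - f w) := by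
      rw [Real.log_le_iff_le_exp h0]; exact hexp
    have h3 : u - 2 * u ^ 2 ≤ 1 - (1 + u)⁻¹ := by
      rw [show 1 - (1 + u)⁻¹ = u / (1 + u) by field_simp; ring, le_div_iff₀ h0]
      nlinarith [sq_nonneg u]
    linarith
  have h4 : f x - f w ≥ N⁻¹ * (u - 2 * (B * n) ^ 2) := by
    have : N⁻¹ * (u - 2 * (B * n) ^ 2) ≤ N⁻¹ * (N * (f x - f w)) :=
      mul_le_mul_of_nonneg_left (by linarith) (inv_pos.2 hN).le
    rwa [inv_mul_cancel_left₀ hN.ne'] at this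
  have h5 : N⁻¹ * (u - 2 * (B * n) ^ 2) = inner ℝ ((N * E)⁻¹ • η) (x - w) -
      N⁻¹ * (E⁻¹ * M + 2 * B ^ 2) * n ^ 2 := by
    rw [real_inner_smul_left, hu, mul_inv]; ring
  linarith

/-- The square root lies below its tangent at b². This bounds norms above by smooth functions,
quadratically in the increment. -/
theorem le_div_two_mul_of_pos {a b : ℝ} (hb : 0 < b) : a ≤ b + (a ^ 2 - b ^ 2) / (2 * b) := by
  have : b + (a ^ 2 - b ^ 2) / (2 * b) - a = (a - b) ^ 2 / (2 * b) := by field_simp; ring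
  have h2 : 0 ≤ (a - b) ^ 2 / (2 * b) := by positivity
  linarith

theorem norm_sub_sq_expand (x w a : X) :
    ‖x - a‖ ^ 2 = ‖w - a‖ ^ 2 + 2 * inner ℝ (w - a) (x - w) + ‖x - w‖ ^ 2 := by
  rw [← norm_add_sq_real]; congr 2; abel

/-- A fuzzy multiplier rule for minimizing the distance to `y` over the level set `{f ≤ m}`. -/
theorem exists_multiplier_of_local_min [CompleteSpace X] {f : X → ℝ}
    (hf : LowerSemicontinuous f) {z : X} {ρ ε : ℝ} (hε : 0 < ε)
    (hbig : ∀ x ∈ Metric.ball z ρ, ∀ ξ ∈ frechetSubdiff f x, ε ≤ ‖ξ‖)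
    {p y : X} {m c r₁ δ : ℝ} (hpy : p ≠ y) (hc : 0 < c) (hp : f p ≤ m) (hr₁ : 0 < r₁)
    (hpz : Metric.closedBall p r₁ ⊆ Metric.ball z ρ)
    (hmin : ∀ x ∈ Metric.closedBall p r₁, f x ≤ m → ‖p - y‖ ≤ ‖x - y‖ + c * ‖x - p‖)
    (hδ : 0 < δ) :
    ∃ w, ‖w - p‖ ≤ δ ∧ ∃ ξ ∈ frechetSubdiff f w, ∃ t : ℝ, 0 < t ∧
      ‖t • ξ - ‖y - w‖⁻¹ • (y - w)‖ ≤ 2 * c := by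
  set D := ‖p - y‖ with hD
  have hD0 : 0 < D := norm_pos_iff.2 (sub_ne_zero.2 hpy)
  obtain ⟨r, hr, hrδ, hrr, hrD⟩ : ∃ r : ℝ, 0 < r ∧ r ≤ δ ∧ r ≤ r₁ / 2 ∧ r ≤ D :=
    ⟨min δ (min (r₁ / 2) D), by positivity, min_le_left _ _,
      (min_le_right _ _).trans (min_le_left _ _), (min_le_right _ _).trans (min_le_right _ _)⟩
  -- Applied with radius r/2, the variational principle then gives a subgradient of norm at most
  -- 4e/(r/2) = c. Thirds of e pay for the move into the level set (t₀), the smoothing at p (τ) and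
  -- the penalty at p (σ).
  set e := c * r / 8 with he
  have he0 : 0 < e := by positivity
  obtain ⟨t₀, ht₀, ht₀r, ht₀e⟩ : ∃ t : ℝ, 0 < t ∧ t ≤ r ∧ (1 + c) * t ≤ e / 3 := by
    refine ⟨min r (e / 3 / (1 + c)), by positivity, min_le_left _ _, ?_⟩
    calc (1 + c) * min r (e / 3 / (1 + c)) ≤ (1 + c) * (e / 3 / (1 + c)) :=
          mul_le_mul_of_nonneg_left (min_le_right _ _) (by positivity)
      _ = e / 3 := by field_simp
  set τ := e / 3 / c with hτ
  have hτ0 : 0 < τ := by positivity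
  have hcτ : c * τ = e / 3 := by rw [hτ]; field_simp
  set σ := e / 3 with hσ
  have hσ0 : 0 < σ := by positivity
  -- The penalty reaches D as soon as f ≥ m + (ε/16) t₀; below that threshold the error bound gives
  -- a point of the level set within t₀.
  set N := D / (σ * (ε / 16 * t₀)) with hN
  have hN0 : 0 < N := by positivity
  have hNexp : ∀ s, ε / 16 * t₀ ≤ s → D ≤ σ * Real.exp (N * s) := by
    intro s hs
    have h1 : D = σ * (N * (ε / 16 * t₀)) := by rw [hN]; field_simp
    have h2 : N * (ε / 16 * t₀) ≤ N * s := mul_le_mul_of_nonneg_left hs hN0.le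
    have h3 := Real.add_one_le_exp (N * s)
    nlinarith
  -- A smoothing of ‖x - p‖ whose gradient has norm at most 1, so the slope term contributes at most
  -- c to the final error.
  set S : X → ℝ := fun x => Real.sqrt (‖x - p‖ ^ 2 + τ ^ 2) with hS
  have hSle : ∀ x, ‖x - p‖ ≤ S x := fun x => Real.le_sqrt_of_sq_le (by nlinarith)
  have hS0 : ∀ x, 0 < S x := fun x => Real.sqrt_pos.2 (by positivity)
  have hSsq : ∀ x, S x ^ 2 = ‖x - p‖ ^ 2 + τ ^ 2 := fun x => Real.sq_sqrt (by positivity)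
  have hSp : S p = τ := by simp [hS, Real.sqrt_sq hτ0.le]
  set F : X → ℝ := fun x => (‖x - y‖ + c * S x) + σ * Real.exp (N * (f x - m)) with hF
  have hlsc : LowerSemicontinuous F := by
    apply LowerSemicontinuous.add
    · exact Continuous.lowerSemicontinuous (by fun_prop)
    · refine Continuous.comp_lowerSemicontinuous (g := fun s => σ * Real.exp (N * (s - m)))
        (by fun_prop) hf ?_
      intro a b hab
      exact mul_le_mul_of_nonneg_left (Real.exp_le_exp.2
        (mul_le_mul_of_nonneg_left (by linarith) hN0.le)) hσ0.le
  have hFp : F p ≤ D + 2 * (e / 3) := by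
    have h1 : Real.exp (N * (f p - m)) ≤ 1 :=
      Real.exp_le_one_iff.2 (mul_nonpos_of_nonneg_of_nonpos hN0.le (by linarith))
    simp only [hF, hSp, hcτ]
    nlinarith
  have happrox : ∀ x ∈ Metric.closedBall p r, F p ≤ F x + e := by
    intro x hx
    have hexp0 : 0 < σ * Real.exp (N * (f x - m)) := by positivity
    have hcS := mul_le_mul_of_nonneg_left (hSle x) hc.le
    have hcn : 0 ≤ c * ‖x - p‖ := by positivity
    rw [Metric.mem_closedBall] at hx
    rcases le_total (f x) (m + ε / 16 * t₀) with hle | hge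
    · obtain ⟨x', hx', hfx'⟩ := exists_le_of_frechetSubdiff_norm_ge hf hε hbig ht₀
        ((Metric.closedBall_subset_closedBall' (by linarith)).trans hpz) hle
      rw [Metric.mem_closedBall] at hx'
      have h1 := hmin x' (Metric.mem_closedBall.2 (by
        linarith [dist_triangle x' x p])) hfx'
      have h2 := dist_triangle x' x p
      have h3 := dist_triangle x' x y
      simp only [dist_eq_norm] at h2 h3 hx'
      have h4 : c * ‖x' - p‖ ≤ c * (t₀ + ‖x - p‖) := mul_le_mul_of_nonneg_left (by linarith) hc.le
      simp only [hF] at hFp ⊢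
      linarith
    · have h1 := hNexp (f x - m) (by linarith)
      have h2 := norm_nonneg (x - y)
      simp only [hF] at hFp ⊢
      linarith
  obtain ⟨w, hwC, ζ, hwp, hζ, hq⟩ := exists_proximal_subgradient_of_approx_min
    Metric.isClosed_closedBall hlsc (Metric.mem_closedBall_self hr.le) he0 (half_pos hr) happrox
  have hζc : ‖ζ‖ ≤ c := by
    refine hζ.trans_eq ?_
    rw [he]; field_simp; norm_num
  set n₀ := ‖w - y‖ with hn₀
  have hn₀0 : 0 < n₀ := by
    have := norm_sub_le_norm_sub_add_norm_sub p w y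
    rw [norm_sub_rev p w] at this
    linarith
  set η : X := ζ - n₀⁻¹ • (w - y) - (c / S w) • (w - p) with hη
  have hmem := mem_frechetSubdiff_of_exp_quadratic_bound (f := f) (w := w) (η := η)
    (M := 2 * e / (r / 2) ^ 2 + (2 * n₀)⁻¹ + c * (2 * S w)⁻¹) (N := N) (m := m) hN0 hσ0 (by
      have hnhds : Metric.closedBall p r ∈ 𝓝 w := by
        refine Metric.closedBall_mem_nhds_of_mem ?_
        rw [Metric.mem_ball, dist_eq_norm]; linarith
      filter_upwards [hnhds] with x hx
      have h1 := hq x hx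
      have h2 := le_div_two_mul_of_pos (a := ‖x - y‖) hn₀0
      rw [norm_sub_sq_expand x w y, ← hn₀] at h2
      have h3 := mul_le_mul_of_nonneg_left (le_div_two_mul_of_pos (a := S x) (hS0 w)) hc.le
      rw [hSsq, hSsq, norm_sub_sq_expand x w p] at h3
      have h2' : n₀ + (n₀ ^ 2 + 2 * inner ℝ (w - y) (x - w) + ‖x - w‖ ^ 2 - n₀ ^ 2) / (2 * n₀) =
          n₀ + n₀⁻¹ * inner ℝ (w - y) (x - w) + (2 * n₀)⁻¹ * ‖x - w‖ ^ 2 := by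
        field_simp; ring
      have hSw := (hS0 w).ne'
      have h3' : c * (S w + (‖w - p‖ ^ 2 + 2 * inner ℝ (w - p) (x - w) + ‖x - w‖ ^ 2 + τ ^ 2 -
          (‖w - p‖ ^ 2 + τ ^ 2)) / (2 * S w)) = c * S w + c / S w * inner ℝ (w - p) (x - w) +
            c * (2 * S w)⁻¹ * ‖x - w‖ ^ 2 := by
        field_simp; ring
      rw [h2'] at h2
      rw [h3'] at h3
      rw [hη, inner_sub_left, inner_sub_left, real_inner_smul_left, real_inner_smul_left]
      simp only [hF] at h1
      linarith)
  -- The multiplier is the derivative of the exponential penalty. What remains is ζ and the gradient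
  -- of c * S, each of norm at most c.
  refine ⟨w, by linarith, _, hmem, N * (σ * Real.exp (N * (f w - m))), by positivity, ?_⟩
  rw [smul_inv_smul₀ (by positivity), norm_sub_rev y w, ← hn₀, hη,
    show ζ - n₀⁻¹ • (w - y) - (c / S w) • (w - p) - n₀⁻¹ • (y - w) = ζ - (c / S w) • (w - p) by
      rw [← neg_sub w y, smul_neg]; abel]
  calc ‖ζ - (c / S w) • (w - p)‖ ≤ ‖ζ‖ + ‖(c / S w) • (w - p)‖ := norm_sub_le _ _
    _ ≤ c + c := by
      refine add_le_add hζc ?_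
      rw [norm_smul, Real.norm_of_nonneg (div_pos hc (hS0 w)).le, div_mul_eq_mul_div,
        div_le_iff₀ (hS0 w)]
      exact mul_le_mul_of_nonneg_left (hSle w) hc.le
    _ = 2 * c := by ring

end

/-! ### Small slope at minimizers over a path component -/

section
variable {Y : Type*} [MetricSpace Y]

/-- If a function has descent of slope `c` at every point of a compact piece of `A`, then there are
fine descending chains starting at the centre. -/
theorem exists_descending_selection {A : Set Y} {q : Y → ℝ} (hq : LipschitzWith 1 q)
    {x₀ : Y} {c δ : ℝ} (hc : 0 < c) (hx₀ : x₀ ∈ A)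
    (hK : IsCompact (A ∩ Metric.closedBall x₀ δ))
    (hdesc : ∀ p ∈ A ∩ Metric.closedBall x₀ δ, ∀ ε > 0, ∃ x ∈ A, dist x p < ε ∧
      q x + c * dist x p < q p)
    {ε : ℝ} (hε : 0 < ε) :
    ∃ γ : ℝ → Y, ∀ t ∈ Icc (q x₀ - c * δ) (q x₀), γ t ∈ A ∩ Metric.closedBall x₀ δ ∧
      t ≤ q (γ t) ∧ q (γ t) ≤ t + ε ∧ c * dist (γ t) x₀ ≤ q x₀ - q (γ t) ∧
      ∀ s ∈ Icc (q x₀ - c * δ) (q x₀), c * dist (γ s) (γ t) ≤ |q (γ s) - q (γ t)| := by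
  set K := A ∩ Metric.closedBall x₀ δ with hKdef
  -- Compactness makes the decrease uniform, so a chain cannot stay in K forever.
  have hunif : ∃ η > 0, ∀ p ∈ K, ∃ x ∈ A, dist x p ≤ ε ∧ q x + c * dist x p ≤ q p ∧
      q x ≤ q p - η := by
    refine hK.induction_on (p := fun s => ∃ η > 0, ∀ p ∈ s, ∃ x ∈ A, dist x p ≤ ε ∧
      q x + c * dist x p ≤ q p ∧ q x ≤ q p - η) ⟨1, one_pos, by simp⟩ ?_ ?_ ?_
    · rintro s t hst ⟨η, hη, h⟩
      exact ⟨η, hη, fun p hp => h p (hst hp)⟩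
    · rintro s t ⟨η, hη, h⟩ ⟨η', hη', h'⟩
      refine ⟨min η η', lt_min hη hη', ?_⟩
      rintro p (hp | hp)
      · obtain ⟨x, hx, h1, h2, h3⟩ := h p hp
        exact ⟨x, hx, h1, h2, by linarith [min_le_left η η']⟩
      · obtain ⟨x, hx, h1, h2, h3⟩ := h' p hp
        exact ⟨x, hx, h1, h2, by linarith [min_le_right η η']⟩
    · intro p hp
      obtain ⟨x, hx, h1, h2⟩ := hdesc p hp ε hε
      have hlt : q x < q p := by
        have := mul_nonneg hc.le (dist_nonneg (x := x) (y := p)); linarith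
      have hqc := hq.continuous
      have e1 : ∀ᶠ p' in 𝓝 p, dist x p' < ε :=
        ((continuous_const.dist continuous_id).tendsto p).eventually_lt_const h1
      have e2 : ∀ᶠ p' in 𝓝 p, q x + c * dist x p' < q p' :=
        ContinuousAt.eventually_lt (f := fun p' => q x + c * dist x p') (by fun_prop)
          hqc.continuousAt h2
      have e3 : ∀ᶠ p' in 𝓝 p, q x + (q p - q x) / 2 < q p' :=
        hqc.continuousAt.eventually_const_lt (by linarith)
      refine ⟨_, mem_nhdsWithin_of_mem_nhds (e1.and (e2.and e3)), (q p - q x) / 2, by linarith, ?_⟩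
      rintro p' ⟨h1, h2, h3⟩
      exact ⟨x, hx, h1.le, h2.le, by linarith⟩
  obtain ⟨η, hη, hstep⟩ := hunif
  choose! g hgA hgε hgc hgη using hstep
  classical
  -- The chain freezes on leaving K. By `hpK` this can happen only once q is below q x₀ - c * δ.
  let p : ℕ → Y := fun k =>
    Nat.rec (motive := fun _ => Y) x₀ (fun _ v => if v ∈ K then g v else v) k
  have hps : ∀ k : ℕ, p (k + 1) = if p k ∈ K then g (p k) else p k := fun _ => rfl
  have hpA : ∀ k, p k ∈ A := by
    intro k
    induction k with
    | zero => exact hx₀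
    | succ k ih => rw [hps]; split_ifs with h; exacts [hgA _ h, ih]
  have hp1 : ∀ k, c * dist (p (k + 1)) (p k) ≤ q (p k) - q (p (k + 1)) := by
    intro k
    rw [hps]; split_ifs with h
    · linarith [hgc _ h]
    · simp
  have hpε : ∀ k, q (p k) ≤ q (p (k + 1)) + ε := by
    intro k
    have h1 := hq.dist_le_mul (p k) (p (k + 1))
    rw [Real.dist_eq, NNReal.coe_one, one_mul] at h1
    have h2 : dist (p k) (p (k + 1)) ≤ ε := by
      rw [hps, dist_comm]; split_ifs with h
      · exact hgε _ h
      · simpa using hε.le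
    linarith [le_abs_self (q (p k) - q (p (k + 1)))]
  have hchain : ∀ j k, j ≤ k → c * dist (p k) (p j) ≤ q (p j) - q (p k) := by
    intro j k hjk
    induction k, hjk using Nat.le_induction with
    | base => simp
    | succ k _ ih =>
      have := mul_le_mul_of_nonneg_left (dist_triangle (p (k + 1)) (p k) (p j)) hc.le
      linarith [hp1 k]
  have hpK : ∀ k, q x₀ - c * δ ≤ q (p k) → p k ∈ K := by
    intro k hk
    refine ⟨hpA k, Metric.mem_closedBall.2 ?_⟩
    have h1 := hchain 0 k (Nat.zero_le k)
    change c * dist (p k) x₀ ≤ q x₀ - q (p k) at h1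
    exact le_of_mul_le_mul_left (by linarith) hc
  have hsel : ∀ t ∈ Icc (q x₀ - c * δ) (q x₀), ∃ k, t ≤ q (p k) ∧ q (p k) ≤ t + ε := by
    intro t ht
    have hex : ∃ k, q (p (k + 1)) < t := by
      by_contra! hcon
      have hall : ∀ k, t ≤ q (p k) := fun k => by
        cases k with
        | zero => exact ht.2
        | succ k => exact hcon k
      have hdrop : ∀ k : ℕ, q (p k) ≤ q x₀ - k * η := by
        intro k
        induction k with
        | zero => simp [p]
        | succ k ih =>
          have hk := hpK k (ht.1.trans (hall k))
          rw [hps, if_pos hk]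
          push_cast
          linarith [hgη _ hk]
      obtain ⟨k, hk⟩ := exists_nat_gt ((q x₀ - t) / η)
      rw [div_lt_iff₀ hη] at hk
      linarith [hall k, hdrop k]
    -- The last link before q first drops below t; one link lowers q by at most ε.
    refine ⟨Nat.find hex, ?_, ?_⟩
    · rcases Nat.eq_zero_or_pos (Nat.find hex) with h0 | h0
      · rw [h0]; exact ht.2
      · have := Nat.find_min hex (Nat.sub_lt h0 one_pos)
        rw [show Nat.find hex - 1 + 1 = Nat.find hex by omega] at this
        exact not_lt.1 this
    · linarith [hpε (Nat.find hex), Nat.find_spec hex]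
  choose! k hk1 hk2 using hsel
  refine ⟨fun t => p (k t), fun t ht => ⟨hpK _ (ht.1.trans (hk1 t ht)), hk1 t ht, hk2 t ht,
    hchain 0 _ (Nat.zero_le _), fun s hs => ?_⟩⟩
  rcases le_total (k t) (k s) with h | h
  · exact (hchain _ _ h).trans ((le_abs_self _).trans_eq (abs_sub_comm _ _))
  · rw [dist_comm]
    exact (hchain _ _ h).trans (le_abs_self _)

/-- If `x₀` minimizes a `1`-Lipschitz function over its path component in a locally compact set `A`,
then arbitrarily close to `x₀` there are points of `A` at which the function has small slope. -/
theorem exists_small_slope_of_min_on_pathComponentIn {A : Set Y} {q : Y → ℝ}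
    (hq : LipschitzWith 1 q) {x₀ : Y} {c δ : ℝ} (hc : 0 < c) (hδ : 0 < δ) (hx₀ : x₀ ∈ A)
    (hK : IsCompact (A ∩ Metric.closedBall x₀ δ))
    (hmin : ∀ x ∈ pathComponentIn A x₀, q x₀ ≤ q x) :
    ∃ p ∈ A ∩ Metric.closedBall x₀ δ, ∃ ε > 0, ∀ x ∈ A, dist x p < ε →
      q p ≤ q x + c * dist x p := by
  by_contra! hdesc
  set K := A ∩ Metric.closedBall x₀ δ with hKdef
  set a := q x₀ - c * δ with ha
  have hab : a < q x₀ := by have := mul_pos hc hδ; linarith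
  have hε : ∀ n : ℕ, (0 : ℝ) < 1 / ((n : ℝ) + 1) := fun n => Nat.one_div_pos_of_nat
  choose γ hγ using fun n : ℕ => exists_descending_selection hq hc hx₀ hK hdesc (hε n)
  -- An ultrafilter gives limits at all levels t at once. Indexing chains by the value of q makes
  -- the limit satisfy q (Γ t) = t and be 1/c-Lipschitz, hence a path.
  let 𝒰 : Ultrafilter ℕ := Filter.hyperfilter ℕ
  have h𝒰 : (𝒰 : Filter ℕ) ≤ atTop := by
    rw [← Nat.cofinite_eq_atTop]; exact Filter.hyperfilter_le_cofinite
  have hlim : ∀ t ∈ Icc a (q x₀), ∃ v ∈ K, Tendsto (fun n => γ n t) 𝒰 (𝓝 v) := by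
    intro t ht
    refine isCompact_iff_ultrafilter_le_nhds'.1 hK (𝒰.map fun n => γ n t) ?_
    exact Filter.mem_map.2 (Filter.Eventually.of_forall fun n => (hγ n t ht).1)
  have : Nonempty Y := ⟨x₀⟩
  choose! Γ hΓK hΓ using hlim
  have hzero : Tendsto (fun n : ℕ => 1 / ((n : ℝ) + 1)) 𝒰 (𝓝 0) :=
    tendsto_one_div_add_atTop_nhds_zero_nat.mono_left h𝒰
  have hqΓ : ∀ t ∈ Icc a (q x₀), q (Γ t) = t := by
    intro t ht
    have h1 : Tendsto (fun n => q (γ n t)) 𝒰 (𝓝 (q (Γ t))) :=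
      (hq.continuous.tendsto _).comp (hΓ t ht)
    refine le_antisymm ?_ (ge_of_tendsto' h1 fun n => (hγ n t ht).2.1)
    have h2 : Tendsto (fun n : ℕ => t + 1 / ((n : ℝ) + 1)) 𝒰 (𝓝 t) := by
      simpa using hzero.const_add t
    exact le_of_tendsto_of_tendsto' h1 h2 fun n => (hγ n t ht).2.2.1
  have hΓlip : ∀ s ∈ Icc a (q x₀), ∀ t ∈ Icc a (q x₀), c * dist (Γ s) (Γ t) ≤ |s - t| := by
    intro s hs t ht
    have h1 : Tendsto (fun n => c * dist (γ n s) (γ n t)) 𝒰 (𝓝 (c * dist (Γ s) (Γ t))) :=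
      ((hΓ s hs).dist (hΓ t ht)).const_mul c
    have h2 : Tendsto (fun n => |q (γ n s) - q (γ n t)|) 𝒰 (𝓝 |q (Γ s) - q (Γ t)|) :=
      (((hq.continuous.tendsto _).comp (hΓ s hs)).sub
        ((hq.continuous.tendsto _).comp (hΓ t ht))).abs
    have := le_of_tendsto_of_tendsto' h1 h2 fun n => (hγ n t ht).2.2.2.2 s hs
    rwa [hqΓ s hs, hqΓ t ht] at this
  have hΓb : Γ (q x₀) = x₀ := by
    have hb : q x₀ ∈ Icc a (q x₀) := right_mem_Icc.2 hab.le
    have h1 : ∀ n, γ n (q x₀) = x₀ := fun n => by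
      obtain ⟨-, h1, -, h2, -⟩ := hγ n _ hb
      have h3 : c * dist (γ n (q x₀)) x₀ ≤ c * 0 := by linarith
      exact dist_le_zero.1 (le_of_mul_le_mul_left h3 hc)
    have h2 := hΓ _ hb
    simp only [h1] at h2
    exact tendsto_nhds_unique h2 tendsto_const_nhds
  have hcont : ContinuousOn Γ (Icc a (q x₀)) := by
    refine (LipschitzOnWith.of_dist_le_mul (K := Real.toNNReal c⁻¹) fun s hs t ht => ?_).continuousOn
    rw [Real.coe_toNNReal _ (inv_pos.2 hc).le, Real.dist_eq, inv_mul_eq_div, le_div_iff₀' hc]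
    exact hΓlip s hs t ht
  have hpath : IsPathConnected (Γ '' Icc a (q x₀)) :=
    ((convex_Icc a (q x₀)).isPathConnected ⟨a, left_mem_Icc.2 hab.le⟩).image' hcont
  have hjoin : JoinedIn A x₀ (Γ a) := by
    refine (hpath.joinedIn x₀ ⟨_, right_mem_Icc.2 hab.le, hΓb⟩ (Γ a)
      ⟨_, left_mem_Icc.2 hab.le, rfl⟩).mono ?_
    rintro _ ⟨t, ht, rfl⟩
    exact (hΓK t ht).1
  have := hmin (Γ a) hjoin
  rw [hqΓ a (left_mem_Icc.2 hab.le)] at this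
  linarith

end

/-! ### Steps of a run -/

/-- In every run, each positive index is created by a step with distinct components. -/
theorem IsLevelSetRun.exists_step {X : Type*} [PseudoMetricSpace X] {f : X → ℝ}
    {U : Set X} {x y : ℕ → X} {l u : ℕ → ℝ} {i : ℕ → ℕ} (h : IsLevelSetRun f U x y l u i) (n : ℕ) :
    ∃ k, i k = n ∧ i (k + 1) = n + 1 ∧
      ¬ JoinedIn (lowerLevel f (l (k + 1)) ∩ U) (x n) (y n) ∧
      IsClosestPair (pathComponentIn (lowerLevel f (l (k + 1)) ∩ U) (x n))
        (pathComponentIn (lowerLevel f (l (k + 1)) ∩ U) (y n)) (x (n + 1)) (y (n + 1)) := by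
  -- The index grows by at most one per step, so the first time it reaches n + 1 comes from a step
  -- with distinct components.
  have hex : ∃ k, n + 1 ≤ i k := (h.infinite.eventually_ge_atTop (n + 1)).exists
  obtain ⟨k, hk⟩ : ∃ k, Nat.find hex = k + 1 := by
    refine Nat.exists_eq_succ_of_ne_zero fun h0 => ?_
    have := Nat.find_spec hex
    rw [h0, h.index_zero] at this
    omega
  have h1 : n + 1 ≤ i (k + 1) := hk ▸ Nat.find_spec hex
  have h2 : i k < n + 1 := not_le.1 (Nat.find_min hex (by omega))
  rcases h.step k with ⟨-, -, -, h3⟩ | ⟨h3, h4, -, h5, h6⟩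
  · omega
  · have h7 : i k = n := by omega
    rw [← h4, h7] at h3 h6
    exact ⟨k, h7, by omega, h3, h6⟩

/-! ### Weak limits and Clarke subdifferentials -/

section
variable {X : Type*} [NormedAddCommGroup X] [InnerProductSpace ℝ X] {f : X → ℝ} {z : X}

theorem WeaklyTendsTo.comp {v : ℕ → X} {w : X} (h : WeaklyTendsTo v w) {φ : ℕ → ℕ}
    (hφ : Tendsto φ atTop atTop) : WeaklyTendsTo (fun n => v (φ n)) w :=
  fun a => (h a).comp hφ

theorem WeaklyTendsTo.smul {v : ℕ → X} {w : X} (h : WeaklyTendsTo v w) {r : ℕ → ℝ} {s : ℝ}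
    (hr : Tendsto r atTop (𝓝 s)) : WeaklyTendsTo (fun n => r n • v n) (s • w) := fun a => by
  simp only [real_inner_smul_left]
  exact hr.mul (h a)

theorem WeaklyTendsTo.congr_norm {v v' : ℕ → X} {w : X} (h : WeaklyTendsTo v w)
    (hv : Tendsto (fun n => v' n - v n) atTop (𝓝 0)) : WeaklyTendsTo v' w := fun a => by
  have h1 := (hv.inner (𝕜 := ℝ) (tendsto_const_nhds (x := a))).add (h a)
  rw [inner_zero_left, zero_add] at h1
  refine h1.congr fun n => ?_
  rw [← inner_add_left, sub_add_cancel]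

/-- Needed because the Clarke subdifferential is a Minkowski sum: a limiting subgradient belongs to
it once 0 is available as singular summand. -/
theorem zero_mem_singularSubgradients {ξ : X} (hξ : ξ ∈ limitingSubgradients f z) :
    (0 : X) ∈ singularSubgradients f z := by
  obtain ⟨p, g, hg, hp, hfp, hw⟩ := hξ
  have h0 : Tendsto (fun n : ℕ => 1 / ((n : ℝ) + 1)) atTop (𝓝 0) :=
    tendsto_one_div_add_atTop_nhds_zero_nat
  refine ⟨p, g, fun n => 1 / ((n : ℝ) + 1), hg, hp, hfp, ?_, ?_⟩
  · exact tendsto_nhdsWithin_iff.2 ⟨h0, Eventually.of_forall fun n =>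
      mem_Ioi.2 Nat.one_div_pos_of_nat⟩
  · simpa only [zero_smul] using hw.smul h0

theorem smul_mem_singularSubgradients {ξ : X} (hξ : ξ ∈ singularSubgradients f z) {t : ℝ}
    (ht : 0 < t) : t • ξ ∈ singularSubgradients f z := by
  obtain ⟨p, g, r, hg, hp, hfp, hr, hw⟩ := hξ
  obtain ⟨hr0, hr1⟩ := tendsto_nhdsWithin_iff.1 hr
  refine ⟨p, g, fun n => t * r n, hg, hp, hfp, tendsto_nhdsWithin_iff.2 ⟨?_, ?_⟩, ?_⟩
  · simpa using hr0.const_mul t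
  · exact hr1.mono fun n hn => mul_pos ht hn
  · simpa only [smul_smul] using hw.smul (tendsto_const_nhds (x := t))

theorem subset_clarkeSingularSubdiff :
    singularSubgradients f z ⊆ clarkeSingularSubdiff f z :=
  (subset_convexHull ℝ _).trans subset_closure

theorem isClarkeCritical_of_zero_mem_convexHull
    (h : (0 : X) ∈ convexHull ℝ (limitingSubgradients f z)) : IsClarkeCritical f z := by
  obtain ⟨ξ, hξ⟩ := convexHull_nonempty_iff.1 ⟨_, h⟩
  exact Set.mem_add.2 ⟨0, subset_closure h, 0,
    subset_clarkeSingularSubdiff (zero_mem_singularSubgradients hξ), add_zero 0⟩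

/-- Singular subgradients form a cone, so -v can be rescaled to cancel s • v. -/
theorem isClarkeCritical_of_limiting_of_singular {v : X} {s : ℝ} (hs : 0 < s)
    (h1 : s • v ∈ limitingSubgradients f z) (h2 : -v ∈ singularSubgradients f z) :
    IsClarkeCritical f z :=
  Set.mem_add.2 ⟨s • v, subset_closure (subset_convexHull ℝ _ h1), s • -v,
    subset_clarkeSingularSubdiff (smul_mem_singularSubgradients h2 hs), by simp⟩

theorem isClarkeCritical_of_limiting_opposite {v : X} {s t : ℝ} (hs : 0 < s) (ht : 0 < t)
    (h1 : s • v ∈ limitingSubgradients f z) (h2 : t • -v ∈ limitingSubgradients f z) :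
    IsClarkeCritical f z := by
  refine isClarkeCritical_of_zero_mem_convexHull ?_
  have := convex_convexHull ℝ (limitingSubgradients f z) (subset_convexHull ℝ _ h1)
    (subset_convexHull ℝ _ h2) (a := t / (s + t)) (b := s / (s + t)) (by positivity)
    (by positivity) (by field_simp; ring)
  convert this using 1
  rw [smul_smul, smul_smul, smul_neg, div_mul_eq_mul_div, div_mul_eq_mul_div, mul_comm t s,
    add_neg_cancel]

theorem containsLineThroughZero_of_singular_opposite {v : X} (hv : v ≠ 0)
    (h1 : v ∈ singularSubgradients f z) (h2 : -v ∈ singularSubgradients f z) :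
    ContainsLineThroughZero (clarkeSingularSubdiff f z) := by
  refine ⟨v, hv, fun t => ?_⟩
  rcases lt_trichotomy t 0 with ht | rfl | ht
  · have := subset_clarkeSingularSubdiff (smul_mem_singularSubgradients h2 (neg_pos.2 ht))
    rwa [neg_smul_neg] at this
  · refine subset_closure ?_
    have := convex_convexHull ℝ (singularSubgradients f z) (subset_convexHull ℝ _ h1)
      (subset_convexHull ℝ _ h2) (a := 1 / 2) (b := 1 / 2) (by norm_num) (by norm_num)
      (by norm_num)
    rwa [smul_neg, add_neg_cancel, ← zero_smul ℝ v] at this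
  · exact subset_clarkeSingularSubdiff (smul_mem_singularSubgradients h1 ht)

/-- Weak limits of boundedly scaled Fréchet subgradients are singular subgradients or positive
multiples of limiting subgradients. -/
theorem singular_or_limiting_of_weaklyTendsTo (hfz : ContinuousAt f z) {w ξ : ℕ → X} {t : ℕ → ℝ}
    {B : ℝ} {v : X} (hw : Tendsto w atTop (𝓝 z)) (hξ : ∀ n, ξ n ∈ frechetSubdiff f (w n))
    (ht : ∀ n, 0 < t n) (htB : ∀ n, t n ≤ B) (hv : WeaklyTendsTo (fun n => t n • ξ n) v) :
    v ∈ singularSubgradients f z ∨ ∃ s : ℝ, 0 < s ∧ s • v ∈ limitingSubgradients f z := by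
  obtain ⟨s, hs, φ, hφ, hlim⟩ := (isCompact_Icc (a := (0 : ℝ)) (b := B)).tendsto_subseq
    (x := t) fun n => ⟨(ht n).le, htB n⟩
  have hwφ := hw.comp hφ.tendsto_atTop
  have hvφ := hv.comp hφ.tendsto_atTop
  rcases hs.1.eq_or_lt with h0 | h0
  · left
    refine ⟨w ∘ φ, ξ ∘ φ, t ∘ φ, fun n => hξ _, hwφ, hfz.tendsto.comp hwφ,
      tendsto_nhdsWithin_iff.2 ⟨h0 ▸ hlim, Eventually.of_forall fun n => ht _⟩, hvφ⟩
  · right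
    refine ⟨s⁻¹, inv_pos.2 h0, w ∘ φ, ξ ∘ φ, fun n => hξ _, hwφ, hfz.tendsto.comp hwφ, ?_⟩
    have := hvφ.smul (hlim.inv₀ h0.ne')
    convert this using 2 with n
    simp only [Function.comp_apply]
    rw [inv_smul_smul₀ (ht _).ne']

/-! ### From closest points to multipliers -/

/-- Near a point of a component of a level set closest to `y` there is a local minimizer of a
slightly perturbed distance to `y` over the whole level set. -/
theorem exists_local_min_of_closest (hf : LowerSemicontinuous f) {U : Set X} (hU : IsOpen U)
    {m : ℝ} {a x y : X} (hx : x ∈ pathComponentIn (lowerLevel f m ∩ U) a)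
    (hmin : ∀ s ∈ pathComponentIn (lowerLevel f m ∩ U) a, dist x y ≤ dist s y)
    (hcomp : FiniteDimensional ℝ X ∨ OtherComponentsAvoid (lowerLevel f m ∩ U) x)
    {c δ : ℝ} (hc : 0 < c) (hδ : 0 < δ) :
    ∃ p, ‖p - x‖ ≤ δ ∧ f p ≤ m ∧ ∃ r > 0, ∀ x' ∈ Metric.closedBall p r, f x' ≤ m →
      ‖p - y‖ ≤ ‖x' - y‖ + c * ‖x' - p‖ := by
  set A := lowerLevel f m ∩ U with hA
  have hxA : x ∈ A := pathComponentIn_subset hx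
  rw [← pathComponentIn_congr hx] at hmin
  rcases hcomp with hfin | hav
  · have : ProperSpace X := FiniteDimensional.proper ℝ X
    obtain ⟨δ', hδ', hδU⟩ := Metric.nhds_basis_closedBall.mem_iff.1 (hU.mem_nhds hxA.2)
    set d := min δ δ' with hd
    have hd0 : 0 < d := lt_min hδ hδ'
    have hdU : Metric.closedBall x d ⊆ U :=
      (Metric.closedBall_subset_closedBall (min_le_right _ _)).trans hδU
    have hK : IsCompact (A ∩ Metric.closedBall x d) := by
      have : A ∩ Metric.closedBall x d = f ⁻¹' Iic m ∩ Metric.closedBall x d := by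
        ext v
        exact ⟨fun h => ⟨h.1.1, h.2⟩, fun h => ⟨⟨h.1, hdU h.2⟩, h.2⟩⟩
      rw [this]
      exact (isCompact_closedBall x d).inter_left (hf.isClosed_preimage m)
    obtain ⟨p, ⟨hpA, hpd⟩, ε, hε, hp⟩ := exists_small_slope_of_min_on_pathComponentIn
      (LipschitzWith.dist_left y) hc hd0 hxA hK hmin
    obtain ⟨r, hr, hrU⟩ := Metric.nhds_basis_closedBall.mem_iff.1 (hU.mem_nhds hpA.2)
    refine ⟨p, ?_, hpA.1, min r (ε / 2), by positivity, fun x' hx' hfx' => ?_⟩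
    · rw [← dist_eq_norm]
      exact (Metric.mem_closedBall.1 hpd).trans (min_le_left _ _)
    · have h1 := Metric.mem_closedBall.1 hx'
      simp only [← dist_eq_norm]
      exact hp x' ⟨hfx', hrU (Metric.mem_closedBall.2 (h1.trans (min_le_left _ _)))⟩
        (by linarith [min_le_right r (ε / 2)])
  -- Here x itself serves: near x the level set coincides with its component.
  · have h1 : (A \ pathComponentIn A x)ᶜ ∩ U ∈ 𝓝 x := by
      refine inter_mem ?_ (hU.mem_nhds hxA.2)
      exact mem_of_superset (isClosed_closure.isOpen_compl.mem_nhds hav)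
        (compl_subset_compl.2 subset_closure)
    obtain ⟨r, hr, hrU⟩ := Metric.nhds_basis_closedBall.mem_iff.1 h1
    refine ⟨x, by simpa using hδ.le, hxA.1, r, hr, fun x' hx' hfx' => ?_⟩
    have h2 := hrU hx'
    have h3 : x' ∈ pathComponentIn A x := by
      by_contra h
      exact h2.1 ⟨⟨hfx', h2.2⟩, h⟩
    have := hmin x' h3
    simp only [← dist_eq_norm]
    have := mul_nonneg hc.le (dist_nonneg (x := x') (y := x))
    linarith

/-- The direction from a closest point of a level set component to `y` is approximated by positive
multiples of Fréchet subgradients at nearby points. -/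
theorem exists_multiplier_of_closest [CompleteSpace X] (hf : LowerSemicontinuous f) {U : Set X}
    (hU : IsOpen U) {ρ ε : ℝ} (hε : 0 < ε)
    (hbig : ∀ x ∈ Metric.ball z ρ, ∀ ξ ∈ frechetSubdiff f x, ε ≤ ‖ξ‖)
    {m : ℝ} {a x y : X} (hx : x ∈ pathComponentIn (lowerLevel f m ∩ U) a)
    (hmin : ∀ s ∈ pathComponentIn (lowerLevel f m ∩ U) a, dist x y ≤ dist s y)
    (hcomp : FiniteDimensional ℝ X ∨ OtherComponentsAvoid (lowerLevel f m ∩ U) x)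
    (hxy : x ≠ y) (hxz : x ∈ Metric.ball z ρ) {κ : ℝ} (hκ : 0 < κ) :
    ∃ w, ‖w - x‖ ≤ κ ∧ ∃ ξ ∈ frechetSubdiff f w, ∃ t : ℝ, 0 < t ∧
      ‖t • ξ - ‖y - x‖⁻¹ • (y - x)‖ ≤ κ := by
  have hcont : ContinuousAt (fun w => ‖y - w‖⁻¹ • (y - w)) x := by
    have : ‖y - x‖ ≠ 0 := norm_ne_zero_iff.2 (sub_ne_zero.2 hxy.symm)
    fun_prop (disch := assumption)
  have hnear : ∀ᶠ w in 𝓝 x, ‖‖y - w‖⁻¹ • (y - w) - ‖y - x‖⁻¹ • (y - x)‖ < κ / 2 := by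
    have := hcont.eventually (Metric.ball_mem_nhds _ (half_pos hκ))
    simpa only [Metric.mem_ball, dist_eq_norm] using this
  obtain ⟨δ, hδ, hball⟩ := Metric.nhds_basis_closedBall.eventually_iff.1
    (hnear.and ((isOpen_ne.eventually_mem hxy).and (Metric.isOpen_ball.eventually_mem hxz)))
  set d := min κ δ / 2 with hd
  have hd0 : 0 < d := by positivity
  have hdκ : 2 * d ≤ κ := by linarith [min_le_left κ δ]
  have hdδ : 2 * d ≤ δ := by linarith [min_le_right κ δ]
  -- Slope κ/4 gives error 2 * (κ/4) = κ/2 in the multiplier rule; the other κ/2 pays for replacing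
  -- the direction at w by the one at x.
  obtain ⟨p, hpx, hfp, r, hr, hp⟩ := exists_local_min_of_closest hf hU hx hmin hcomp
    (c := κ / 4) (by positivity) hd0
  have hpball := hball (x := p) (by rw [Metric.mem_closedBall, dist_eq_norm]; linarith)
  obtain ⟨r', hr', hr'z⟩ := Metric.nhds_basis_closedBall.mem_iff.1
    (Metric.isOpen_ball.mem_nhds hpball.2.2)
  obtain ⟨w, hwp, ξ, hξ, t, ht, hest⟩ := exists_multiplier_of_local_min hf hε hbig
    hpball.2.1 (show 0 < κ / 4 by positivity) hfp (r₁ := min r r') (by positivity)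
    ((Metric.closedBall_subset_closedBall (min_le_right _ _)).trans hr'z)
    (fun x' hx' => hp x' (Metric.closedBall_subset_closedBall (min_le_left _ _) hx')) hd0
  have hwx : ‖w - x‖ ≤ 2 * d := by
    linarith [norm_sub_le_norm_sub_add_norm_sub w p x]
  have hwball := hball (x := w) (by rw [Metric.mem_closedBall, dist_eq_norm]; linarith)
  refine ⟨w, by linarith, ξ, hξ, t, ht, ?_⟩
  have := norm_sub_le_norm_sub_add_norm_sub (t • ξ) (‖y - w‖⁻¹ • (y - w)) (‖y - x‖⁻¹ • (y - x))
  linarith [hwball.1]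

/-- Both unit directions between the iterates of a run are approximated by positive multiples of
Fréchet subgradients at nearby points. -/
theorem IsLevelSetRun.exists_multipliers [CompleteSpace X] (hf : LowerSemicontinuous f)
    {U : Set X} {x y : ℕ → X} {l u : ℕ → ℝ} {i : ℕ → ℕ} (hrun : IsLevelSetRun f U x y l u i)
    (hcomp : FiniteDimensional ℝ X ∨ ∀ k, i (k + 1) = i k + 1 →
      OtherComponentsAvoid (lowerLevel f (l (k + 1)) ∩ U) (x (i (k + 1))) ∧
      OtherComponentsAvoid (lowerLevel f (l (k + 1)) ∩ U) (y (i (k + 1))))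
    {ρ ε : ℝ} (hε : 0 < ε) (hbig : ∀ x ∈ Metric.ball z ρ, ∀ ξ ∈ frechetSubdiff f x, ε ≤ ‖ξ‖)
    {n : ℕ} (hn : 1 ≤ n) (hx : x n ∈ Metric.ball z ρ) (hy : y n ∈ Metric.ball z ρ)
    {κ : ℝ} (hκ : 0 < κ) :
    (∃ w, ‖w - x n‖ ≤ κ ∧ ∃ ξ ∈ frechetSubdiff f w, ∃ t : ℝ, 0 < t ∧
      ‖t • ξ - ‖y n - x n‖⁻¹ • (y n - x n)‖ ≤ κ) ∧
    ∃ w, ‖w - y n‖ ≤ κ ∧ ∃ ξ ∈ frechetSubdiff f w, ∃ t : ℝ, 0 < t ∧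
      ‖t • ξ - -(‖y n - x n‖⁻¹ • (y n - x n))‖ ≤ κ := by
  obtain ⟨n, rfl⟩ := Nat.exists_eq_add_of_le' hn
  obtain ⟨k, hk1, hk2, hk3, hxS, hyS, hle⟩ := hrun.exists_step n
  have hxy : x (n + 1) ≠ y (n + 1) := fun h =>
    hk3 (JoinedIn.trans hxS (h ▸ JoinedIn.symm hyS))
  have hcompx : FiniteDimensional ℝ X ∨
      OtherComponentsAvoid (lowerLevel f (l (k + 1)) ∩ U) (x (n + 1)) :=
    hcomp.imp_right fun h => hk2 ▸ (h k (by omega)).1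
  have hcompy : FiniteDimensional ℝ X ∨
      OtherComponentsAvoid (lowerLevel f (l (k + 1)) ∩ U) (y (n + 1)) :=
    hcomp.imp_right fun h => hk2 ▸ (h k (by omega)).2
  refine ⟨exists_multiplier_of_closest hf hrun.isOpen hε hbig hxS
    (fun s hs => hle s hs _ hyS) hcompx hxy hx hκ, ?_⟩
  have := exists_multiplier_of_closest hf hrun.isOpen hε hbig hyS (y := x (n + 1))
    (fun s hs => by rw [dist_comm, dist_comm s]; exact hle _ hxS s hs) hcompy hxy.symm hy hκ
  rwa [norm_sub_rev, ← neg_sub (y (n + 1)), smul_neg] at this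

/-- A weak limit of scaled Fréchet subgradients which are bounded away from zero. -/
theorem singular_or_limiting_of_approx (hfz : ContinuousAt f z) {ρ ε : ℝ} (hρ : 0 < ρ)
    (hε : 0 < ε) (hbig : ∀ x ∈ Metric.ball z ρ, ∀ ξ ∈ frechetSubdiff f x, ε ≤ ‖ξ‖)
    {a d : ℕ → X} {v : X} (ha : Tendsto a atTop (𝓝 z)) (hd1 : ∀ n, ‖d n‖ ≤ 1)
    (hd : WeaklyTendsTo d v)
    (h : ∀ᶠ n in atTop, ∀ κ : ℝ, 0 < κ → ∃ w, ‖w - a n‖ ≤ κ ∧ ∃ ξ ∈ frechetSubdiff f w,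
      ∃ t : ℝ, 0 < t ∧ ‖t • ξ - d n‖ ≤ κ) :
    v ∈ singularSubgradients f z ∨ ∃ s : ℝ, 0 < s ∧ s • v ∈ limitingSubgradients f z := by
  have hκ : ∀ n : ℕ, (0 : ℝ) < 1 / ((n : ℝ) + 1) := fun n => Nat.one_div_pos_of_nat
  have hκ1 : ∀ n : ℕ, 1 / ((n : ℝ) + 1) ≤ 1 := fun n => by
    rw [div_le_one (by positivity)]; linarith [n.cast_nonneg (α := ℝ)]
  have hκ0 : Tendsto (fun n : ℕ => 1 / ((n : ℝ) + 1)) atTop (𝓝 0) :=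
    tendsto_one_div_add_atTop_nhds_zero_nat
  obtain ⟨n₀, hn₀⟩ := eventually_atTop.1 (h.and ((ha.eventually
    (Metric.ball_mem_nhds z (half_pos hρ))).and (hκ0.eventually_lt_const (half_pos hρ))))
  have hshift : Tendsto (fun n => n + n₀) atTop atTop := tendsto_add_atTop_nat n₀
  choose w hw ξ hξ t ht hest using fun n =>
    (hn₀ (n + n₀) (Nat.le_add_left _ _)).1 _ (hκ (n + n₀))
  have hκs := hκ0.comp hshift
  have hwz : Tendsto w atTop (𝓝 z) := by
    have h1 : Tendsto (fun n => w n - a (n + n₀)) atTop (𝓝 0) := squeeze_zero_norm hw hκs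
    simpa using h1.add (ha.comp hshift)
  -- Eventually ‖t • ξ‖ ≤ ‖d‖ + 1 ≤ 2, and ‖ξ‖ ≥ ε, whence t ≤ 2/ε.
  refine singular_or_limiting_of_weaklyTendsTo hfz hwz hξ ht (B := 2 / ε) (fun n => ?_)
    ((hd.comp hshift).congr_norm (squeeze_zero_norm hest hκs))
  have hball : w n ∈ Metric.ball z ρ := by
    have h1 := (hn₀ (n + n₀) (Nat.le_add_left _ _)).2
    have h2 := hw n
    have h3 := h1.1
    rw [dist_eq_norm] at h3
    rw [mem_ball_iff_norm]
    linarith [norm_sub_le_norm_sub_add_norm_sub (w n) (a (n + n₀)) z, h1.2]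
  have h1 := hbig _ hball _ (hξ n)
  have h2 : ‖t n • ξ n‖ ≤ 2 := by
    have := norm_sub_norm_le (t n • ξ n) (d (n + n₀))
    linarith [hest n, hκ1 (n + n₀), hd1 (n + n₀)]
  rw [norm_smul, Real.norm_of_nonneg (ht n).le] at h2
  rw [le_div_iff₀ hε]
  exact (mul_le_mul_of_nonneg_left h1 (ht n).le).trans h2

/-- Arbitrarily small Fréchet subgradients arbitrarily close to `z` make `z` Clarke critical. -/
theorem isClarkeCritical_of_small_subgradients (hfz : ContinuousAt f z)
    (h : ∀ ε > 0, ∃ x ∈ Metric.ball z ε, ∃ ξ ∈ frechetSubdiff f x, ‖ξ‖ < ε) :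
    IsClarkeCritical f z := by
  choose p hp ξ hξ hlt using fun n : ℕ => h (1 / ((n : ℝ) + 1)) Nat.one_div_pos_of_nat
  have hκ0 : Tendsto (fun n : ℕ => 1 / ((n : ℝ) + 1)) atTop (𝓝 0) :=
    tendsto_one_div_add_atTop_nhds_zero_nat
  have hpz : Tendsto p atTop (𝓝 z) :=
    tendsto_iff_dist_tendsto_zero.2 (squeeze_zero (fun _ => dist_nonneg)
      (fun n => (Metric.mem_ball.1 (hp n)).le) hκ0)
  have hξ0 : Tendsto ξ atTop (𝓝 0) := squeeze_zero_norm (fun n => (hlt n).le) hκ0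
  refine isClarkeCritical_of_zero_mem_convexHull (subset_convexHull ℝ _
    ⟨p, ξ, hξ, hpz, hfz.tendsto.comp hpz, fun a => ?_⟩)
  exact hξ0.inner tendsto_const_nhds

end

/-! ### The trichotomy -/

theorem mainTheorem11 {X : Type*} [NormedAddCommGroup X] [InnerProductSpace ℝ X] [CompleteSpace X]
    (f : X → ℝ) (hf : LowerSemicontinuous f)
    (U : Set X) (x y : ℕ → X) (l u : ℕ → ℝ) (i : ℕ → ℕ)
    (hrun : IsLevelSetRun f U x y l u i)
    (hcomp : FiniteDimensional ℝ X ∨ ∀ k, i (k + 1) = i k + 1 →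
      OtherComponentsAvoid (lowerLevel f (l (k + 1)) ∩ U) (x (i (k + 1))) ∧
      OtherComponentsAvoid (lowerLevel f (l (k + 1)) ∩ U) (y (i (k + 1))))
    (z : X) (hz : MapClusterPt (z, z) atTop (fun n => (x n, y n)))
    (hfz : ContinuousAt f z) :
    IsClarkeCritical f z ∨
    ContainsLineThroughZero (clarkeSingularSubdiff f z) ∨
    ∀ φ : ℕ → ℕ, StrictMono φ →
      Tendsto (fun n => (x (φ n), y (φ n))) atTop (𝓝 (z, z)) →
      WeaklyTendsTo (fun n => ‖y (φ n) - x (φ n)‖⁻¹ • (y (φ n) - x (φ n))) 0 := by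
  by_cases hsmall : ∀ ε > 0, ∃ x ∈ Metric.ball z ε, ∃ ξ ∈ frechetSubdiff f x, ‖ξ‖ < ε
  · exact Or.inl (isClarkeCritical_of_small_subgradients hfz hsmall)
  push Not at hsmall
  obtain ⟨ε, hε, hbig⟩ := hsmall
  by_contra! hcon
  obtain ⟨hcrit, hline, φ, hφ, hlim, hnot⟩ := hcon
  -- It suffices that every subsequence has a further one with limit 0; weak compactness provides a
  -- weak limit v, and v ≠ 0 is to be excluded.
  refine hnot fun a => tendsto_of_subseq_tendsto fun ns hns => ?_
  set d : ℕ → X := fun n => ‖y n - x n‖⁻¹ • (y n - x n) with hd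
  have hd1 : ∀ n, ‖d n‖ ≤ 1 := fun n => by
    rw [hd, norm_smul, norm_inv, norm_norm]; exact inv_mul_le_one
  obtain ⟨v, ms, hms, hv⟩ := exists_subseq_weaklyTendsTo (fun n => d (φ (ns n)))
    (fun n => hd1 _)
  refine ⟨ms, ?_⟩
  suffices hv0 : v = 0 by rw [← hv0]; exact hv a
  by_contra hv0
  have hN' : Tendsto (fun n => ns (ms n)) atTop atTop := hns.comp hms.tendsto_atTop
  have hN : Tendsto (fun n => φ (ns (ms n))) atTop atTop := hφ.tendsto_atTop.comp hN'
  have hlimN := hlim.comp hN'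
  have hxN : Tendsto (fun n => x (φ (ns (ms n)))) atTop (𝓝 z) :=
    (continuous_fst.tendsto _).comp hlimN
  have hyN : Tendsto (fun n => y (φ (ns (ms n)))) atTop (𝓝 z) :=
    (continuous_snd.tendsto _).comp hlimN
  have hball := Metric.ball_mem_nhds z hε
  have hev := ((hN.eventually_ge_atTop 1).and
    ((hxN.eventually hball).and (hyN.eventually hball))).mono
    fun n hn κ (hκ : (0 : ℝ) < κ) =>
      hrun.exists_multipliers hf hcomp hε hbig hn.1 hn.2.1 hn.2.2 hκ
  have hX := singular_or_limiting_of_approx hfz hε hε hbig hxN (fun n => hd1 _) hv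
    (hev.mono fun n hn κ hκ => (hn κ hκ).1)
  have hY := singular_or_limiting_of_approx hfz hε hε hbig hyN
    (d := fun n => -d (φ (ns (ms n)))) (v := -v) (fun n => by rw [norm_neg]; exact hd1 _)
    (by simpa using hv.smul (tendsto_const_nhds (x := (-1 : ℝ))))
    (hev.mono fun n hn κ hκ => (hn κ hκ).2)
  rcases hX with hX | ⟨s, hs, hX⟩ <;> rcases hY with hY | ⟨t, ht, hY⟩
  · exact hline (containsLineThroughZero_of_singular_opposite hv0 hX hY)
  · exact hcrit (isClarkeCritical_of_limiting_of_singular ht hY (by rwa [neg_neg]))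
  · exact hcrit (isClarkeCritical_of_limiting_of_singular hs hX hY)
  · exact hcrit (isClarkeCritical_of_limiting_opposite hs ht hX hY)
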